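/- Let $Y=XB^*+C^*+\mathcal E$, where $X\in\mathbb R^{n\times p}$, $B^*\in\mathbb R^{p\times m}$, $C^*\in\mathbb R^{n\times m}$ and $\mathcal E\in\mathbb R^{n\times m}$ has independent $N(0,\sigma^2)$ entries. Put $q=\operatorname{rank}(X)$, $M(B,C)=\|XB+C\|_F^2$, and let $J(C)$ be the number of nonzero rows of $C$. Let $\lambda=A\sigma(m+\log n)^{1/2}$ and let $P(\cdot;\lambda):\mathbb R\to\mathbb R$ be a penalty such that $P(0;\lambda)=0$ and, for all $t\in\mathbb R$, $$P(t;\lambda)\ \ge\ P_H(t;\lambda)=\bigl(-t^2/2+\lambda|t|\bigr)1_{|t|<\lambda}+(\lambda^2/2)\,1_{|t|\ge\lambda},\qquad P(t;\lambda)\le c\,\lambda^2 .$$ Let $r\ge 1$ and let $(\hat B,\hat C)$ be a (random) global minimizer of $$\tfrac12\|Y-XB-C\|_F^2+\sum_{i=1}^nP(\|c_i\|_2;\lambda)\quad\text{subject to}\quad \operatorname{rank}(B)\le r,$$ where $c_i$ is the $i$th row of $C$. Then there is a universal constant $A_0>0$ such that for every $A\ge A_0$ and every $c>0$ there is a constant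 $K>0$, depending only on $A$ and $c$, such that the prediction error is integrable and $$E\{M(\hat B-B^*,\hat C-C^*)\}\ \le\ K\inf_{(B,C):\,\operatorname{rank}(B)\le r}\bigl\{M(B-B^*,C-C^*)+\sigma^2(q+m)r+\sigma^2J(C)m+\sigma^2J(C)\log n\bigr\}.$$ In particular, if $r=r^*=\operatorname{rank}(B^*)$ and $J^*=J(C^*)$, then $$E\{M(\hat B-B^*,\hat C-C^*)\}\ \le\ K\bigl\{\sigma^2(q+m)r^*+\sigma^2J^*(m+\log n)\bigr\}.$$ -/

import Mathlib

open MeasureTheory ProbabilityTheory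
open scoped NNReal

namespace RobustRRR

noncomputable section

/-- The squared Frobenius norm of a real matrix (the norm is Mathlib's Frobenius norm). -/
def frobSq {n m : ℕ} (A : Matrix (Fin n) (Fin m) ℝ) : ℝ :=
  letI := Matrix.frobeniusNormedAddCommGroup (m := Fin n) (n := Fin m) (α := ℝ)
  ‖A‖ ^ 2

/-- The Euclidean norm of the `i`-th row of `C`. -/
def rowNorm {n m : ℕ} (C : Matrix (Fin n) (Fin m) ℝ) (i : Fin n) : ℝ :=
  ‖WithLp.toLp 2 (C i)‖

/-- `J(C)`: the number of nonzero rows of `C`. -/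
def numNonzeroRows {n m : ℕ} (C : Matrix (Fin n) (Fin m) ℝ) : ℕ :=
  {i : Fin n | C i ≠ 0}.ncard

/-- `M(B, C) = ‖X B + C‖_F ^ 2`. -/
def predErr {n p m : ℕ} (X : Matrix (Fin n) (Fin p) ℝ)
    (B : Matrix (Fin p) (Fin m) ℝ) (C : Matrix (Fin n) (Fin m) ℝ) : ℝ :=
  frobSq (X * B + C)

/-- The hard-thresholding penalty `P_H(t; lam)`. -/
def hardPenalty (t lam : ℝ) : ℝ :=
  if |t| < lam then -t ^ 2 / 2 + lam * |t| else lam ^ 2 / 2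

/-- The row-wise penalized least squares criterion
`‖Y - X B - C‖_F ^ 2 / 2 + ∑ i, P(‖c_i‖₂; lam)`. -/
def objective {n p m : ℕ} (P : ℝ → ℝ → ℝ) (lam : ℝ)
    (X : Matrix (Fin n) (Fin p) ℝ) (Y : Matrix (Fin n) (Fin m) ℝ)
    (B : Matrix (Fin p) (Fin m) ℝ) (C : Matrix (Fin n) (Fin m) ℝ) : ℝ :=
  frobSq (Y - X * B - C) / 2 + ∑ i, P (rowNorm C i) lam

/-- `(Bh, Ch)` is a global minimizer of the criterion subject to `rank B ≤ r`. -/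
def IsGlobalMinimizer {n p m : ℕ} (P : ℝ → ℝ → ℝ) (lam : ℝ) (r : ℕ)
    (X : Matrix (Fin n) (Fin p) ℝ) (Y : Matrix (Fin n) (Fin m) ℝ)
    (Bh : Matrix (Fin p) (Fin m) ℝ) (Ch : Matrix (Fin n) (Fin m) ℝ) : Prop :=
  Bh.rank ≤ r ∧
    ∀ (B : Matrix (Fin p) (Fin m) ℝ) (C : Matrix (Fin n) (Fin m) ℝ), B.rank ≤ r →
      objective P lam X Y Bh Ch ≤ objective P lam X Y B C

/-- The noise matrix `E` has independent `N(0, σ ^ 2)` entries. -/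
def IsGaussianNoise {n m : ℕ} {Ω : Type*} [MeasurableSpace Ω] (μ : Measure Ω) (σ : ℝ≥0)
    (E : Ω → Matrix (Fin n) (Fin m) ℝ) : Prop :=
  (∀ i j, HasLaw (fun ω => E ω i j) (gaussianReal 0 (σ ^ 2)) μ) ∧
    iIndepFun (fun (ij : Fin n × Fin m) ω => E ω ij.1 ij.2) μ

/-- The threshold level `lam = A σ (m + log n) ^ (1/2)`. -/
def threshLevel (A : ℝ) (σ : ℝ≥0) (n m : ℕ) : ℝ :=
  A * σ * Real.sqrt (m + Real.log n)

end

end RobustRRR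

namespace RobustRRR

/-! Comparing the criterion at the minimizer with its value at a competitor `(B, C)` leaves the
noise term `⟨E, W⟩`, where `W = X B₁ + D`, `rank B₁ ≤ 2r` and `D = Ĉ - C`. Since `P ≥ P_H` and `P_H`
is subadditive, the penalties pay for `∑ P_H(‖d_i‖)` at a cost of order `λ² J(C)`. It remains to
dominate `⟨E, W⟩ - ‖W‖²/8 - ∑ P_H(‖d_i‖)`, uniformly in `B₁` and `D`, by a variable `R` of mean
`O(σ²(q+m)r)` (`predErr_le_of_isGlobalMinimizer`, `exists_noise_bound`).

The supremum over `D` splits by rows: up to constants, either `d_i = 0` or the row absorbs its noise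
and pays `λ²/2` (`inner_add_sub_le_max`). If `I` is the set of absorbing rows, half of each payment
offsets `‖e_i‖²`, whose excess is rare, and the other half pays for the union over all `I`. The
remaining rows carry a Gaussian process over matrices `X_I B₁` of low rank with `rank X_I ≤ q`,
which a net of size `exp(O(r(q+m)))` controls (`exists_lowRank_net`).

Suprema are replaced by finite sums of exponential square moments, so `R` is explicit and
integrable. The choice of `λ` makes the weights `exp(-c λ²/σ²)` at most `e^{-m}/n`, which keeps the
sums over `I` and over rows bounded. -/

/-- The trace inner product of two real matrices. -/
def frobInner {n m : ℕ} (E W : Matrix (Fin n) (Fin m) ℝ) : ℝ :=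
  ∑ i, ∑ j, E i j * W i j

theorem frobSq_eq_sum {n m : ℕ} (A : Matrix (Fin n) (Fin m) ℝ) :
    frobSq A = ∑ i, ∑ j, A i j ^ 2 := by
  unfold frobSq
  rw [Matrix.frobenius_norm_def]
  rw [← Real.sqrt_eq_rpow, Real.sq_sqrt]
  · simp
  · positivity

theorem rowNorm_sq {n m : ℕ} (A : Matrix (Fin n) (Fin m) ℝ) (i : Fin n) :
    rowNorm A i ^ 2 = ∑ j, A i j ^ 2 := by
  simp [rowNorm, EuclideanSpace.norm_sq_eq]

theorem frobSq_eq_sum_rowNorm {n m : ℕ} (A : Matrix (Fin n) (Fin m) ℝ) :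
    frobSq A = ∑ i, rowNorm A i ^ 2 := by
  simp [frobSq_eq_sum, rowNorm_sq]

theorem frobSq_nonneg {n m : ℕ} (A : Matrix (Fin n) (Fin m) ℝ) : 0 ≤ frobSq A := by
  rw [frobSq_eq_sum]; positivity

theorem frobInner_eq_sum_inner {n m : ℕ} (E W : Matrix (Fin n) (Fin m) ℝ) :
    frobInner E W = ∑ i, inner ℝ (WithLp.toLp 2 (E i)) (WithLp.toLp 2 (W i)) := by
  simp [frobInner, PiLp.inner_apply, mul_comm]

/-! ### The hard-thresholding penalty -/

theorem hardPenalty_nonneg {t lam : ℝ} (h : 0 ≤ lam) : 0 ≤ hardPenalty t lam := by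
  unfold hardPenalty
  split_ifs with ht
  · nlinarith [abs_nonneg t, sq_abs t]
  · positivity

theorem hardPenalty_le {t lam : ℝ} : hardPenalty t lam ≤ lam ^ 2 / 2 := by
  unfold hardPenalty
  split_ifs with ht
  · nlinarith [sq_nonneg (|t| - lam), sq_abs t]
  · exact le_rfl

/-- Subadditivity of the hard-thresholding penalty, combined with its monotonicity. -/
theorem hardPenalty_le_add {u s t lam : ℝ} (hu : 0 ≤ u) (hs : 0 ≤ s) (ht : 0 ≤ t)
    (h : u ≤ s + t) (hl : 0 ≤ lam) :
    hardPenalty u lam ≤ hardPenalty s lam + hardPenalty t lam := by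
  by_cases h1 : s < lam
  · by_cases h2 : t < lam
    · have es : hardPenalty s lam = -s ^ 2 / 2 + lam * s := by
        simp [hardPenalty, abs_of_nonneg hs, h1]
      have et : hardPenalty t lam = -t ^ 2 / 2 + lam * t := by
        simp [hardPenalty, abs_of_nonneg ht, h2]
      rw [es, et]
      by_cases h3 : s + t < lam
      · have eu : hardPenalty u lam = -u ^ 2 / 2 + lam * u := by
          simp [hardPenalty, abs_of_nonneg hu, lt_of_le_of_lt h h3]
        rw [eu]
        nlinarith [mul_nonneg hs ht]
      · refine hardPenalty_le.trans ?_
        push Not at h3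
        -- The overshoot `s + t - lam` is nonnegative and below both `s` and `t`. The claim is
        -- equivalent to `(s + t - lam) ^ 2 ≤ 2 * s * t`.
        have : (s + t - lam) ^ 2 ≤ s * t := by nlinarith
        nlinarith
    · have et : hardPenalty t lam = lam ^ 2 / 2 := by
        simp [hardPenalty, abs_of_nonneg ht, h2]
      have := hardPenalty_nonneg (t := s) hl
      have := hardPenalty_le (t := u) (lam := lam)
      linarith
  · have es : hardPenalty s lam = lam ^ 2 / 2 := by
      simp [hardPenalty, abs_of_nonneg hs, h1]
    have := hardPenalty_nonneg (t := t) hl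
    have := hardPenalty_le (t := u) (lam := lam)
    linarith

/-! ### Deterministic reduction to a noise bound -/

/-- Maximizing a single-row criterion over an outlier vector `d`: up to constants the
maximum is attained by `d = 0` or by fitting the noise perfectly. -/
theorem inner_add_sub_le_max {F : Type*} [NormedAddCommGroup F] [InnerProductSpace ℝ F]
    (e g d : F) (lam : ℝ) :
    inner ℝ e (g + d) - ‖g + d‖ ^ 2 / 8 - hardPenalty ‖d‖ lam ≤
      max (inner ℝ e g - ‖g‖ ^ 2 / 8) (2 * ‖e‖ ^ 2 - lam ^ 2 / 2) := by
  set t := ‖d‖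
  set z := ‖(4 : ℝ) • e - g‖ with hz
  have ht : 0 ≤ t := norm_nonneg _
  have hz0 : 0 ≤ z := norm_nonneg _
  have hzt : inner ℝ ((4 : ℝ) • e - g) d ≤ z * t := real_inner_le_norm _ _
  rw [inner_sub_left, real_inner_smul_left] at hzt
  have hz2 : z ^ 2 = 16 * ‖e‖ ^ 2 - 8 * inner ℝ e g + ‖g‖ ^ 2 := by
    rw [hz, norm_sub_sq_real, norm_smul, real_inner_smul_left]
    norm_num
    ring
  have hgd : ‖g + d‖ ^ 2 = ‖g‖ ^ 2 + 2 * inner ℝ g d + t ^ 2 := norm_add_sq_real _ _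
  rw [inner_add_right, hgd]
  unfold hardPenalty
  rw [abs_of_nonneg ht]
  split_ifs with h
  -- The bound is now a convex quadratic in `t` on `[0, lam]`, so an endpoint is optimal; `5 / 2 *
  -- lam` is the value of `z` at which the two endpoints tie.
  · by_cases h2 : z ≤ 5 / 2 * lam
    · refine le_max_of_le_left ?_
      nlinarith
    · refine le_max_of_le_right ?_
      push Not at h2
      nlinarith [sq_nonneg (z - lam), mul_nonneg (sub_nonneg.2 h.le) (sub_nonneg.2 h2.le), mul_nonneg ht (sub_nonneg.2 h.le)]
  · refine le_max_of_le_right ?_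
    nlinarith [sq_nonneg (z - t)]

/-- The stochastic term of the basic inequality is controlled by the clean rows, penalized
by the number of removed rows, and by the rows with unusually large noise. -/
theorem frobInner_sub_le {n m : ℕ} (E G D : Matrix (Fin n) (Fin m) ℝ) (lam : ℝ) :
    ∃ I : Finset (Fin n),
      frobInner E (G + D) - frobSq (G + D) / 8 - ∑ i, hardPenalty (rowNorm D i) lam ≤
        (∑ i ∈ Iᶜ, (inner ℝ (WithLp.toLp 2 (E i)) (WithLp.toLp 2 (G i)) - rowNorm G i ^ 2 / 8)
          - I.card * (lam ^ 2 / 4)) + ∑ i, max 0 (2 * rowNorm E i ^ 2 - lam ^ 2 / 4) := by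
  classical
  set a : Fin n → ℝ := fun i =>
    inner ℝ (WithLp.toLp 2 (E i)) (WithLp.toLp 2 (G i)) - rowNorm G i ^ 2 / 8
  set b : Fin n → ℝ := fun i => 2 * rowNorm E i ^ 2 - lam ^ 2 / 2
  refine ⟨Finset.univ.filter fun i => a i < b i, ?_⟩
  set I := Finset.univ.filter fun i => a i < b i
  have h1 : frobInner E (G + D) - frobSq (G + D) / 8 - ∑ i, hardPenalty (rowNorm D i) lam ≤
      ∑ i, max (a i) (b i) := by
    rw [frobInner_eq_sum_inner, frobSq_eq_sum_rowNorm, Finset.sum_div, ← Finset.sum_sub_distrib,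
      ← Finset.sum_sub_distrib]
    exact Finset.sum_le_sum fun i _ =>
      inner_add_sub_le_max (WithLp.toLp 2 (E i)) (WithLp.toLp 2 (G i)) (WithLp.toLp 2 (D i)) lam
  refine h1.trans ?_
  rw [← Finset.sum_add_sum_compl I]
  have h2 : ∑ i ∈ Iᶜ, max (a i) (b i) = ∑ i ∈ Iᶜ, a i := by
    refine Finset.sum_congr rfl fun i hi => max_eq_left ?_
    simpa [I] using hi
  -- The payment `lam ^ 2 / 2` is split evenly between the noise excess and the count of removed
  -- rows.
  have h3 : ∑ i ∈ I, max (a i) (b i) ≤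
      ∑ i ∈ I, (max 0 (2 * rowNorm E i ^ 2 - lam ^ 2 / 4) - lam ^ 2 / 4) := by
    refine Finset.sum_le_sum fun i hi => ?_
    have : a i < b i := by simpa [I] using hi
    rw [max_eq_right this.le]
    have := le_max_right 0 (2 * rowNorm E i ^ 2 - lam ^ 2 / 4)
    simp only [b]
    linarith
  have h4 : ∑ i ∈ I, max 0 (2 * rowNorm E i ^ 2 - lam ^ 2 / 4) ≤
      ∑ i, max 0 (2 * rowNorm E i ^ 2 - lam ^ 2 / 4) :=
    Finset.sum_le_sum_of_subset_of_nonneg (Finset.subset_univ _) fun i _ _ => le_max_left _ _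
  rw [Finset.sum_sub_distrib, Finset.sum_const, nsmul_eq_mul] at h3
  linarith

theorem matrix_rank_sub_le {p m : ℕ} (A B : Matrix (Fin p) (Fin m) ℝ) :
    (A - B).rank ≤ A.rank + B.rank := by
  unfold Matrix.rank
  refine (Submodule.finrank_mono ?_).trans (Submodule.finrank_add_le_finrank_add_finrank _ _)
  rintro _ ⟨v, rfl⟩
  rw [Matrix.mulVecLin_apply, Matrix.sub_mulVec]
  exact Submodule.sub_mem _ (Submodule.mem_sup_left ⟨v, rfl⟩) (Submodule.mem_sup_right ⟨v, rfl⟩)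

/-- The basic inequality: a global minimizer satisfies an oracle inequality as soon as the
stochastic term is controlled by `R`. -/
theorem predErr_le_of_isGlobalMinimizer {n p m r : ℕ} {P : ℝ → ℝ → ℝ} {lam c R : ℝ}
    (hl : 0 ≤ lam) (hP0 : P 0 lam = 0) (hP : ∀ t, hardPenalty t lam ≤ P t lam)
    (hPc : ∀ t, P t lam ≤ c * lam ^ 2)
    {X : Matrix (Fin n) (Fin p) ℝ} {Bstar Bh B : Matrix (Fin p) (Fin m) ℝ}
    {Cstar E Ch C : Matrix (Fin n) (Fin m) ℝ} (hB : B.rank ≤ r)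
    (hmin : IsGlobalMinimizer P lam r X (X * Bstar + Cstar + E) Bh Ch)
    (hR : ∀ (B₁ : Matrix (Fin p) (Fin m) ℝ) (D : Matrix (Fin n) (Fin m) ℝ), B₁.rank ≤ 2 * r →
      frobInner E (X * B₁ + D) - frobSq (X * B₁ + D) / 8 - ∑ i, hardPenalty (rowNorm D i) lam ≤ R) :
    predErr X (Bh - Bstar) (Ch - Cstar) ≤
      3 * predErr X (B - Bstar) (C - Cstar) + 8 * (c * lam ^ 2) * numNonzeroRows C + 4 * R := by
  have hobj := hmin.2 B C hB
  have hrank : (Bh - B).rank ≤ 2 * r := by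
    have := matrix_rank_sub_le Bh B
    have := hmin.1
    omega
  have hR' := hR (Bh - B) (Ch - C) hrank
  set U := X * (Bh - Bstar) + (Ch - Cstar) with hU
  set V := X * (B - Bstar) + (C - Cstar) with hV
  have hW : X * (Bh - B) + (Ch - C) = U - V := by
    rw [hU, hV]; simp only [Matrix.mul_sub]; abel
  rw [hW] at hR'
  have hYh : X * Bstar + Cstar + E - X * Bh - Ch = E - U := by
    rw [hU]; simp only [Matrix.mul_sub]; abel
  have hY : X * Bstar + Cstar + E - X * B - C = E - V := by
    rw [hV]; simp only [Matrix.mul_sub]; abel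
  unfold objective at hobj
  rw [hYh, hY] at hobj
  have e1 : frobSq (E - U) - frobSq (E - V) =
      frobSq U - frobSq V - 2 * frobInner E (U - V) := by
    simp only [frobSq_eq_sum, frobInner, Finset.mul_sum, ← Finset.sum_sub_distrib]
    refine Finset.sum_congr rfl fun i _ => Finset.sum_congr rfl fun j _ => ?_
    simp only [Matrix.sub_apply]; ring
  have e2 : frobSq (U - V) ≤ 2 * frobSq U + 2 * frobSq V := by
    simp only [frobSq_eq_sum, Finset.mul_sum, ← Finset.sum_add_distrib]
    refine Finset.sum_le_sum fun i _ => Finset.sum_le_sum fun j _ => ?_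
    simp only [Matrix.sub_apply]; nlinarith [sq_nonneg (U i j + V i j)]
  have e3 : ∑ i, hardPenalty (rowNorm (Ch - C) i) lam ≤
      ∑ i, P (rowNorm Ch i) lam + ∑ i, P (rowNorm C i) lam := by
    rw [← Finset.sum_add_distrib]
    refine Finset.sum_le_sum fun i _ => ?_
    refine (hardPenalty_le_add (norm_nonneg _) (norm_nonneg _) (norm_nonneg _) ?_ hl).trans
      (add_le_add (hP (rowNorm Ch i)) (hP (rowNorm C i)))
    exact norm_sub_le (WithLp.toLp 2 (Ch i)) (WithLp.toLp 2 (C i))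
  have e4 : ∑ i, P (rowNorm C i) lam ≤ c * lam ^ 2 * numNonzeroRows C := by
    classical
    have : numNonzeroRows C = (Finset.univ.filter fun i => C i ≠ 0).card := by
      rw [numNonzeroRows, ← Set.ncard_coe_finset]; simp
    rw [this, ← Finset.sum_filter_add_sum_filter_not Finset.univ (fun i => C i ≠ 0)]
    have hz : ∑ i with ¬ C i ≠ 0, P (rowNorm C i) lam = 0 := by
      refine Finset.sum_eq_zero fun i hi => ?_
      have : C i = 0 := by simpa using hi
      simp [rowNorm, this, hP0]
    rw [hz, add_zero]
    refine (Finset.sum_le_card_nsmul _ _ _ fun i _ => hPc _).trans ?_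
    rw [nsmul_eq_mul, mul_comm]
  unfold predErr
  rw [← hU, ← hV]
  linarith

/-! ### Nets for balls, low-rank matrices and rows -/

/-- The closed unit ball of a finite-dimensional normed space has a `1/2`-net with at most
`5 ^ dim` points. -/
theorem exists_half_net (F : Type*) [NormedAddCommGroup F] [NormedSpace ℝ F]
    [FiniteDimensional ℝ F] :
    ∃ N : Finset F, N.card ≤ 5 ^ Module.finrank ℝ F ∧ (∀ y ∈ N, ‖y‖ ≤ 1) ∧
      ∀ x : F, ‖x‖ ≤ 1 → ∃ y ∈ N, ‖x - y‖ ≤ 1 / 2 := by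
  classical
  -- A largest 1-separated set in the ball of radius 2 covers that ball at distance 1; halving it
  -- gives the net. The volume bound 5 ^ dim makes a largest size exist.
  let p : ℕ → Prop := fun k => ∃ s : Finset F, s.card = k ∧ (∀ c ∈ s, ‖c‖ ≤ 2) ∧
    ∀ c ∈ s, ∀ d ∈ s, c ≠ d → 1 ≤ ‖c - d‖
  have h0 : p 0 := ⟨∅, by simp⟩
  obtain ⟨s, hcard, hs, hsep⟩ : p (Nat.findGreatest p (5 ^ Module.finrank ℝ F)) :=
    Nat.findGreatest_spec (Nat.zero_le _) h0
  refine ⟨s.image fun c => (1 / 2 : ℝ) • c, ?_, ?_, ?_⟩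
  · exact Finset.card_image_le.trans (Besicovitch.card_le_of_separated s hs hsep)
  · intro y hy
    obtain ⟨c, hc, rfl⟩ := Finset.mem_image.1 hy
    rw [norm_smul]
    have := hs c hc
    norm_num
    linarith
  · intro x hx
    suffices h : ∃ c ∈ s, ‖(2 : ℝ) • x - c‖ ≤ 1 by
      obtain ⟨c, hc, hxc⟩ := h
      refine ⟨_, Finset.mem_image_of_mem _ hc, ?_⟩
      have : x - (1 / 2 : ℝ) • c = (1 / 2 : ℝ) • ((2 : ℝ) • x - c) := by
        rw [smul_sub, smul_smul]; norm_num
      rw [this, norm_smul]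
      norm_num
      linarith
    by_contra! hno
    have hx2 : ‖(2 : ℝ) • x‖ ≤ 2 := by
      rw [norm_smul]; norm_num; linarith
    have hnot : (2 : ℝ) • x ∉ s := fun hmem => by
      have := hno _ hmem
      norm_num at this
    have hp : p (s.card + 1) := by
      refine ⟨insert ((2 : ℝ) • x) s, Finset.card_insert_of_notMem hnot, ?_, ?_⟩
      · intro c hc
        rcases Finset.mem_insert.1 hc with rfl | hc
        · exact hx2
        · exact hs c hc
      · intro c hc d hd hcd
        rcases Finset.mem_insert.1 hc with rfl | hc <;> rcases Finset.mem_insert.1 hd with rfl | hd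
        · exact absurd rfl hcd
        · exact (hno d hd).le
        · rw [norm_sub_rev]; exact (hno c hc).le
        · exact hsep c hc d hd hcd
    have hle : s.card + 1 ≤ 5 ^ Module.finrank ℝ F := by
      obtain ⟨s', hs', h1, h2⟩ := hp
      rw [← hs']
      exact Besicovitch.card_le_of_separated s' h1 h2
    have := Nat.le_findGreatest hle hp
    omega

/-- A linear functional is determined up to a factor two by its values on a `1/2`-net. -/
theorem abs_le_of_half_net {F : Type*} [NormedAddCommGroup F] [NormedSpace ℝ F]
    [FiniteDimensional ℝ F] {N : Finset F}
    (hN : ∀ x : F, ‖x‖ ≤ 1 → ∃ y ∈ N, ‖x - y‖ ≤ 1 / 2) (f : F →ₗ[ℝ] ℝ) {a : ℝ} (ha : 0 ≤ a)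
    (hf : ∀ y ∈ N, |f y| ≤ a) (x : F) : |f x| ≤ 2 * a * ‖x‖ := by
  let g : F →L[ℝ] ℝ := f.toContinuousLinearMap
  have hg : ∀ x, g x = f x := fun x => rfl
  -- Approximating by the net costs half the operator norm, which is then absorbed on the left.
  have key : ‖g‖ ≤ a + ‖g‖ / 2 := by
    refine g.opNorm_le_of_unit_norm (by positivity) fun x hx => ?_
    obtain ⟨y, hy, hxy⟩ := hN x hx.le
    have h1 : g x = g y + g (x - y) := by simp
    rw [h1]
    refine (norm_add_le _ _).trans (add_le_add (hf y hy) ?_)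
    refine (g.le_opNorm _).trans ?_
    nlinarith [norm_nonneg g]
  have h2 : ‖g‖ ≤ 2 * a := by linarith
  refine (g.le_opNorm x).trans ?_
  gcongr

/-- A finite-dimensional inner product space of dimension at most `s` embeds isometrically in
`s`-dimensional Euclidean space. -/
theorem exists_linearIsometry_euclideanSpace {F : Type*} [NormedAddCommGroup F]
    [InnerProductSpace ℝ F] [FiniteDimensional ℝ F] {s : ℕ} (h : Module.finrank ℝ F ≤ s) :
    Nonempty (F →ₗᵢ[ℝ] EuclideanSpace ℝ (Fin s)) := by
  let b := stdOrthonormalBasis ℝ F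
  let f : F →ₗ[ℝ] EuclideanSpace ℝ (Fin s) :=
    b.toBasis.constr ℝ fun k => EuclideanSpace.basisFun (Fin s) ℝ (Fin.castLE h k)
  refine ⟨f.isometryOfOrthonormal (v := b.toBasis) (by simp [b.orthonormal]) ?_⟩
  have : f ∘ b.toBasis = EuclideanSpace.basisFun (Fin s) ℝ ∘ Fin.castLE h := by
    ext1 k
    exact b.toBasis.constr_basis ℝ _ k
  rw [this]
  exact (EuclideanSpace.basisFun (Fin s) ℝ).orthonormal.comp _ (Fin.castLE_injective h)

/-- The matrices `X * Z` with `s` columns, seen as tuples of rows. -/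
def rowTuples {n p : ℕ} (X : Matrix (Fin n) (Fin p) ℝ) (s : ℕ) :
    Submodule ℝ (PiLp 2 fun _ : Fin n => EuclideanSpace ℝ (Fin s)) :=
  LinearMap.range
    ({ toFun := fun v => WithLp.toLp 2 fun i => WithLp.toLp 2 fun k => (v k).1 i
       map_add' := fun _ _ => rfl
       map_smul' := fun _ _ => rfl } :
      (Fin s → LinearMap.range X.mulVecLin) →ₗ[ℝ] PiLp 2 fun _ : Fin n => EuclideanSpace ℝ (Fin s))

theorem finrank_rowTuples_le {n p : ℕ} (X : Matrix (Fin n) (Fin p) ℝ) (s : ℕ) :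
    Module.finrank ℝ (rowTuples X s) ≤ s * X.rank := by
  refine (LinearMap.finrank_range_le _).trans ?_
  rw [Module.finrank_pi_fintype]
  simp [Matrix.rank]

theorem mem_rowTuples {n p s : ℕ} (X : Matrix (Fin n) (Fin p) ℝ)
    (z : Fin p → EuclideanSpace ℝ (Fin s)) :
    (WithLp.toLp 2 fun i => ∑ l, X i l • z l) ∈ rowTuples X s := by
  refine ⟨fun k => ⟨X.mulVecLin fun l => z l k, LinearMap.mem_range_self _ _⟩, ?_⟩
  ext i k
  change X.mulVec (fun l => z l k) i = (∑ l, X i l • z l).ofLp k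
  simp [Matrix.mulVec, dotProduct]

/-- Unit-norm matrices `X * B` with `rank B ≤ s` are finitely many up to constants: a finite set
of at most `5 ^ (s * (q + m))` matrices controls the linear process over all of them. -/
theorem exists_lowRank_net {n p m : ℕ} (X : Matrix (Fin n) (Fin p) ℝ) (s : ℕ) :
    ∃ N : Finset (Matrix (Fin n) (Fin m) ℝ), N.card ≤ 5 ^ (s * (X.rank + m)) ∧
      (∀ W ∈ N, frobSq W ≤ 1) ∧
      ∀ (E : Matrix (Fin n) (Fin m) ℝ) (a : ℝ), 0 ≤ a → (∀ W ∈ N, |frobInner E W| ≤ a) →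
        ∀ B : Matrix (Fin p) (Fin m) ℝ, B.rank ≤ s →
          frobInner E (X * B) - frobSq (X * B) / 8 ≤ 32 * a ^ 2 := by
  classical
  obtain ⟨N₁, hc₁, hb₁, hn₁⟩ :=
    exists_half_net (EuclideanSpace ℝ (Fin s) →L[ℝ] EuclideanSpace ℝ (Fin m))
  obtain ⟨N₂, hc₂, hb₂, hn₂⟩ := exists_half_net (rowTuples X s)
  -- A matrix `X * B` of rank at most `s` factors through `s`-dimensional space as `T` applied to
  -- the rows of `H`. The product of nets has dimension `s * m + s * q`, and bilinearity loses a
  -- factor two in each variable.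
  let w : (EuclideanSpace ℝ (Fin s) →L[ℝ] EuclideanSpace ℝ (Fin m)) →
      (rowTuples X s) → Matrix (Fin n) (Fin m) ℝ := fun T H => Matrix.of fun i => (T (H.1 i)).ofLp
  have hw : ∀ T H i, WithLp.toLp 2 (w T H i) = T (H.1 i) := fun T H i => rfl
  refine ⟨(N₁ ×ˢ N₂).image fun x => w x.1 x.2, ?_, ?_, ?_⟩
  · refine Finset.card_image_le.trans ?_
    rw [Finset.card_product]
    have hd : Module.finrank ℝ (EuclideanSpace ℝ (Fin s) →L[ℝ] EuclideanSpace ℝ (Fin m)) = s * m := by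
      rw [← LinearMap.toContinuousLinearMap.finrank_eq, Module.finrank_linearMap]
      simp
    rw [hd] at hc₁
    calc N₁.card * N₂.card ≤ 5 ^ (s * m) * 5 ^ (s * X.rank) :=
          Nat.mul_le_mul hc₁
            (hc₂.trans (Nat.pow_le_pow_right (by norm_num) (finrank_rowTuples_le X s)))
      _ = 5 ^ (s * (X.rank + m)) := by rw [← pow_add]; ring_nf
  · intro W hW
    obtain ⟨⟨T, H⟩, hx, rfl⟩ := Finset.mem_image.1 hW
    obtain ⟨hT, hH⟩ := Finset.mem_product.1 hx
    have hT := hb₁ _ hT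
    have hH := hb₂ _ hH
    rw [frobSq_eq_sum_rowNorm]
    calc ∑ i, rowNorm (w T H) i ^ 2 ≤ ∑ i, ‖H.1 i‖ ^ 2 := by
          refine Finset.sum_le_sum fun i _ => ?_
          have h1 : rowNorm (w T H) i ≤ ‖H.1 i‖ := by
            rw [rowNorm, hw]
            refine (T.le_opNorm _).trans ?_
            exact mul_le_of_le_one_left (norm_nonneg _) hT
          exact pow_le_pow_left₀ (norm_nonneg _) h1 2
      _ = ‖H.1‖ ^ 2 := by rw [PiLp.norm_sq_eq_of_L2]
      _ ≤ 1 := pow_le_one₀ (norm_nonneg _) hH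
  · intro E a ha hN B hB
    have bil : ∀ T H, frobInner E (w T H) = ∑ i, inner ℝ (WithLp.toLp 2 (E i)) (T (H.1 i)) := by
      intro T H
      rw [frobInner_eq_sum_inner]
      rfl
    have h1 : ∀ T ∈ N₁, ∀ H, |frobInner E (w T H)| ≤ 2 * a * ‖H‖ := by
      intro T hT H
      let f : rowTuples X s →ₗ[ℝ] ℝ :=
        { toFun := fun H => frobInner E (w T H)
          map_add' := fun H H' => by
            simp only [bil, ← Finset.sum_add_distrib, ← inner_add_right, ← map_add]; rfl
          map_smul' := fun c H => by
            simp only [bil, RingHom.id_apply, smul_eq_mul, Finset.mul_sum,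
              ← real_inner_smul_right, ← map_smul]; rfl }
      exact abs_le_of_half_net hn₂ f ha
        (fun y hy => hN _ (Finset.mem_image.2 ⟨(T, y), Finset.mk_mem_product hT hy, rfl⟩)) H
    have h2 : ∀ T H, |frobInner E (w T H)| ≤ 2 * (2 * a * ‖H‖) * ‖T‖ := by
      intro T H
      let f : (EuclideanSpace ℝ (Fin s) →L[ℝ] EuclideanSpace ℝ (Fin m)) →ₗ[ℝ] ℝ :=
        { toFun := fun T => frobInner E (w T H)
          map_add' := fun T T' => by
            simp only [bil, ← Finset.sum_add_distrib, ← inner_add_right]; rfl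
          map_smul' := fun c T => by
            simp only [bil, RingHom.id_apply, smul_eq_mul, Finset.mul_sum,
              ← real_inner_smul_right]; rfl }
      exact abs_le_of_half_net hn₁ f (by positivity) (fun T hT => h1 T hT H) T
    let S : Submodule ℝ (EuclideanSpace ℝ (Fin m)) :=
      Submodule.span ℝ (Set.range fun l => WithLp.toLp 2 (B l))
    have hS : Module.finrank ℝ S ≤ s := by
      refine le_trans (le_of_eq ?_) hB
      rw [B.rank_eq_finrank_span_row]
      have hmap : S = (Submodule.span ℝ (Set.range B.row)).map
          (WithLp.linearEquiv 2 ℝ (Fin m → ℝ)).symm.toLinearMap := by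
        rw [Submodule.map_span, ← Set.range_comp]; rfl
      rw [hmap]
      exact LinearEquiv.finrank_map_eq _ _
    obtain ⟨ι⟩ := exists_linearIsometry_euclideanSpace hS
    let b : Fin p → S := fun l => ⟨WithLp.toLp 2 (B l), Submodule.subset_span ⟨l, rfl⟩⟩
    let g : Fin n → S := fun i => ∑ l, X i l • b l
    have hg : ∀ i, (g i : EuclideanSpace ℝ (Fin m)) = WithLp.toLp 2 ((X * B) i) := by
      intro i
      ext j
      simp [g, b, Matrix.mul_apply]
    -- The adjoint of the isometry `ι` is a contraction inverting it on its range, so `T` undoes `ι`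
    -- and `‖H‖` equals the Frobenius norm of `X * B`.
    let T : EuclideanSpace ℝ (Fin s) →L[ℝ] EuclideanSpace ℝ (Fin m) :=
      S.subtypeL ∘L ι.toContinuousLinearMap.adjoint
    have hT : ‖T‖ ≤ 1 := by
      refine (ContinuousLinearMap.opNorm_comp_le _ _).trans ?_
      have h3 : ‖S.subtypeL‖ ≤ 1 := S.norm_subtypeL_le
      have h4 : ‖ι.toContinuousLinearMap.adjoint‖ ≤ 1 := by
        rw [LinearIsometryEquiv.norm_map]
        exact ι.norm_toContinuousLinearMap_le
      exact mul_le_one₀ h3 (by positivity) h4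
    have hTι : ∀ x : S, T (ι x) = x := by
      intro x
      have : ι.toContinuousLinearMap.adjoint (ι x) = x := by
        refine ext_inner_right ℝ fun y => ?_
        rw [ContinuousLinearMap.adjoint_inner_left]
        exact ι.inner_map_map x y
      simp [T, this]
    let H : rowTuples X s := ⟨_, mem_rowTuples X fun l => ι (b l)⟩
    have hH : ∀ i, H.1 i = ι (g i) := by
      intro i
      simp [H, g]
    have hwTH : w T H = X * B := by
      ext1 i
      have := hw T H i
      rw [hH, hTι, hg] at this
      exact congrFun (congrArg WithLp.ofLp this)
    have hnorm : ‖H‖ ^ 2 = frobSq (X * B) := by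
      rw [frobSq_eq_sum_rowNorm, ← Submodule.norm_coe, PiLp.norm_sq_eq_of_L2]
      refine Finset.sum_congr rfl fun i _ => ?_
      rw [hH, ι.norm_map, ← Submodule.norm_coe, hg, rowNorm]
    have h5 := h2 T H
    rw [hwTH] at h5
    have h6 := (le_abs_self _).trans h5
    have h7 : 2 * (2 * a * ‖H‖) * ‖T‖ ≤ 2 * (2 * a * ‖H‖) :=
      mul_le_of_le_one_right (by positivity) hT
    rw [← hnorm]
    nlinarith [sq_nonneg (‖H‖ - 16 * a)]

/-- A finite set of at most `5 ^ m` unit vectors controls the Euclidean norm of a row. -/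
theorem exists_row_net {n m : ℕ} (i : Fin n) :
    ∃ N : Finset (Matrix (Fin n) (Fin m) ℝ), N.card ≤ 5 ^ m ∧ (∀ W ∈ N, frobSq W ≤ 1) ∧
      ∀ (E : Matrix (Fin n) (Fin m) ℝ) (a : ℝ), 0 ≤ a → (∀ W ∈ N, |frobInner E W| ≤ a) →
        rowNorm E i ≤ 2 * a := by
  classical
  obtain ⟨N, hc, hb, hn⟩ := exists_half_net (EuclideanSpace ℝ (Fin m))
  let w : EuclideanSpace ℝ (Fin m) → Matrix (Fin n) (Fin m) ℝ :=
    fun v => Matrix.of fun k => if k = i then v.ofLp else 0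
  have hw : ∀ E v, frobInner E (w v) = inner ℝ (WithLp.toLp 2 (E i)) v := by
    intro E v
    rw [frobInner, Finset.sum_eq_single i]
    · simp [w, PiLp.inner_apply, mul_comm]
    · intro k _ hk
      simp [w, hk]
    · simp
  refine ⟨N.image w, ?_, ?_, ?_⟩
  · simpa using Finset.card_image_le.trans hc
  · intro W hW
    obtain ⟨v, hv, rfl⟩ := Finset.mem_image.1 hW
    have h1 := hb v hv
    have : frobSq (w v) = ‖v‖ ^ 2 := by
      rw [frobSq_eq_sum, Finset.sum_eq_single i, EuclideanSpace.norm_sq_eq]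
      · simp [w]
      · intro k _ hk
        simp [w, hk]
      · simp
    rw [this]
    exact pow_le_one₀ (norm_nonneg _) h1
  · intro E a ha hN
    have h := abs_le_of_half_net hn (innerₛₗ ℝ (WithLp.toLp 2 (E i))) ha
      (fun v hv => by
        rw [innerₛₗ_apply_apply, ← hw]
        exact hN _ (Finset.mem_image_of_mem _ hv)) (WithLp.toLp 2 (E i))
    rw [innerₛₗ_apply_apply, real_inner_self_eq_norm_sq, abs_of_nonneg (by positivity)] at h
    change ‖WithLp.toLp 2 (E i)‖ ≤ 2 * a
    by_contra! hlt
    nlinarith [norm_nonneg (WithLp.toLp 2 (E i))]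

/-! ### Exponential square moments of Gaussian noise -/

section Gaussian

variable {n m : ℕ} {Ω : Type*} [MeasurableSpace Ω] {μ : Measure Ω} [IsProbabilityMeasure μ]
  {σ : ℝ≥0} {E : Ω → Matrix (Fin n) (Fin m) ℝ}

/-- Linear functionals of Gaussian noise are centered Gaussian. -/
theorem IsGaussianNoise.map_frobInner (hE : IsGaussianNoise μ σ E)
    (W : Matrix (Fin n) (Fin m) ℝ) :
    AEMeasurable (fun ω => frobInner (E ω) W) μ ∧
    μ.map (fun ω => frobInner (E ω) W) = gaussianReal 0 ((σ : ℝ) ^ 2 * frobSq W).toNNReal := by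
  let Y : Fin n × Fin m → Ω → ℝ := fun ij ω => E ω ij.1 ij.2 * W ij.1 ij.2
  have hY : ∀ ij, HasLaw (Y ij)
      (gaussianReal 0 (.mk (W ij.1 ij.2 ^ 2) (sq_nonneg _) * σ ^ 2)) μ := fun ij => by
    simpa using gaussianReal_mul_const (hE.1 ij.1 ij.2) (W ij.1 ij.2)
  have hYg : ∀ ij, HasGaussianLaw (Y ij) μ := fun ij => (hY ij).hasGaussianLaw
  have hind : iIndepFun Y μ :=
    hE.2.comp (fun ij x => x * W ij.1 ij.2) fun ij => measurable_id.mul_const _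
  have hsum : (fun ω => frobInner (E ω) W) = ∑ ij, Y ij := by
    ext ω
    simp [frobInner, Y, Fintype.sum_prod_type]
  have hg : HasGaussianLaw (∑ ij, Y ij) μ := hind.hasGaussianLaw_sum hYg
  rw [hsum]
  refine ⟨hg.aemeasurable, ?_⟩
  rw [hg.map_eq_gaussianReal]
  congr 2
  · have : ∀ ij, ∫ ω, Y ij ω ∂μ = 0 := fun ij => by
      rw [(hY ij).integral_eq, integral_id_gaussianReal]
    simp only [Finset.sum_apply]
    rw [integral_finsetSum _ fun ij _ => (hYg ij).memLp_two.integrable (by norm_num)]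
    simp [this]
  · rw [IndepFun.variance_sum (fun ij _ => (hYg ij).memLp_two)
      fun ij _ kl _ h => hind.indepFun h]
    have : ∀ ij, Var[Y ij; μ] = (σ : ℝ) ^ 2 * W ij.1 ij.2 ^ 2 := fun ij => by
      rw [(hY ij).variance_eq, variance_id_gaussianReal]
      push_cast
      exact mul_comm _ _
    simp only [this]
    rw [frobSq_eq_sum, Fintype.sum_prod_type, Finset.mul_sum]
    simp [Finset.mul_sum]

/-- The exponential weight only lowers the Gaussian rate to `b ≥ 1 / (4 * v)`, so the integral is `1
/ √(2 * v * b) ≤ √2`. Variance zero has no density and is treated apart. -/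
theorem gaussianReal_exp_sq {v : ℝ≥0} {s : ℝ} (hs : 0 < s) (hv : (v : ℝ) ≤ s) :
    Integrable (fun x => Real.exp (x ^ 2 / (4 * s))) (gaussianReal 0 v) ∧
      ∫ x, Real.exp (x ^ 2 / (4 * s)) ∂(gaussianReal 0 v) ≤ 2 := by
  by_cases h0 : v = 0
  · subst h0
    rw [gaussianReal_zero_var]
    refine ⟨integrable_dirac (by simp), ?_⟩
    simp
  have hv0 : (0 : ℝ) < v := by positivity
  set b : ℝ := 1 / (2 * v) - 1 / (4 * s) with hb
  have hb1 : 1 / (4 * v) ≤ b := by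
    have h1 : 1 / (4 * s) ≤ 1 / (4 * (v : ℝ)) := by gcongr
    have h2 : 1 / (2 * (v : ℝ)) = 2 * (1 / (4 * v)) := by field_simp; norm_num
    rw [hb, h2]; linarith
  have hb0 : 0 < b := lt_of_lt_of_le (by positivity) hb1
  have hpdf : ∀ x : ℝ, gaussianPDFReal 0 v x * Real.exp (x ^ 2 / (4 * s)) =
      (√(2 * Real.pi * v))⁻¹ * Real.exp (-b * x ^ 2) := fun x => by
    rw [gaussianPDFReal_def]
    simp only [mul_assoc, ← Real.exp_add]
    congr 2
    rw [hb]
    field_simp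
    ring
  constructor
  · rw [gaussianReal_of_var_ne_zero 0 h0,
      integrable_withDensity_iff_integrable_smul' (measurable_gaussianPDF 0 v)
        (Filter.Eventually.of_forall fun x => gaussianPDF_lt_top)]
    simp only [toReal_gaussianPDF, smul_eq_mul, hpdf]
    exact (integrable_exp_neg_mul_sq hb0).const_mul _
  · rw [integral_gaussianReal_eq_integral_smul h0]
    simp only [smul_eq_mul, hpdf]
    rw [integral_const_mul, integral_gaussian]
    rw [inv_mul_le_iff₀ (by positivity)]
    refine Real.sqrt_le_iff.2 ⟨by positivity, ?_⟩
    rw [mul_pow, Real.sq_sqrt (by positivity), div_le_iff₀ hb0]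
    have h3 : 1 ≤ 4 * v * b := by
      have := mul_le_mul_of_nonneg_left hb1 (by positivity : (0 : ℝ) ≤ 4 * v)
      rwa [mul_one_div_cancel (by positivity)] at this
    nlinarith [Real.pi_pos]

/-- Exponential square moments of unit-norm linear functionals of Gaussian noise. -/
theorem IsGaussianNoise.exp_sq_frobInner (hE : IsGaussianNoise μ σ E) (hσ : 0 < σ)
    {W : Matrix (Fin n) (Fin m) ℝ} (hW : frobSq W ≤ 1) :
    Integrable (fun ω => Real.exp (frobInner (E ω) W ^ 2 / (4 * (σ : ℝ) ^ 2))) μ ∧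
      ∫ ω, Real.exp (frobInner (E ω) W ^ 2 / (4 * (σ : ℝ) ^ 2)) ∂μ ≤ 2 := by
  obtain ⟨hm, hmap⟩ := hE.map_frobInner W
  have hσ' : (0 : ℝ) < (σ : ℝ) ^ 2 := by positivity
  obtain ⟨h1, h2⟩ := gaussianReal_exp_sq (v := ((σ : ℝ) ^ 2 * frobSq W).toNNReal) hσ' (by
    rw [Real.coe_toNNReal _ (mul_nonneg hσ'.le (frobSq_nonneg W))]
    exact mul_le_of_le_one_right hσ'.le hW)
  rw [← hmap] at h1 h2
  refine ⟨h1.comp_aemeasurable hm, ?_⟩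
  rwa [integral_map hm h1.aestronglyMeasurable] at h2

/-- The exponential square sum `1 + ∑ exp (⟨E, W⟩ ^ 2 / (4 v))` over a finite set of matrices. -/
noncomputable def expSqSum (v : ℝ) (N : Finset (Matrix (Fin n) (Fin m) ℝ))
    (E : Matrix (Fin n) (Fin m) ℝ) : ℝ :=
  1 + ∑ W ∈ N, Real.exp (frobInner E W ^ 2 / (4 * v))

theorem IsGaussianNoise.integral_expSqSum (hE : IsGaussianNoise μ σ E) (hσ : 0 < σ)
    {N : Finset (Matrix (Fin n) (Fin m) ℝ)} (hN : ∀ W ∈ N, frobSq W ≤ 1) :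
    Integrable (fun ω => expSqSum ((σ : ℝ) ^ 2) N (E ω)) μ ∧
      ∫ ω, expSqSum ((σ : ℝ) ^ 2) N (E ω) ∂μ ≤ 1 + 2 * N.card := by
  have hint := integrable_finsetSum N fun W hW => (hE.exp_sq_frobInner hσ (hN W hW)).1
  refine ⟨(integrable_const 1).add hint, ?_⟩
  unfold expSqSum
  rw [integral_add (integrable_const 1) hint,
    integral_finsetSum _ fun W hW => (hE.exp_sq_frobInner hσ (hN W hW)).1]
  have := Finset.sum_le_card_nsmul N _ 2 fun W hW => (hE.exp_sq_frobInner hσ (hN W hW)).2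
  simp only [integral_const, probReal_univ, smul_eq_mul, mul_one, nsmul_eq_mul] at this ⊢
  linarith

end Gaussian

/-! ### From exponential sums to pointwise bounds -/

theorem expSqSum_nonneg {n m : ℕ} (v : ℝ) (N : Finset (Matrix (Fin n) (Fin m) ℝ))
    (E : Matrix (Fin n) (Fin m) ℝ) : 0 ≤ expSqSum v N E := by
  unfold expSqSum; positivity

/-- `expSqSum` bounds the maximum of the linear process over a finite set. -/
theorem exists_bound_of_expSqSum {n m : ℕ} {v : ℝ} (hv : 0 < v)
    (N : Finset (Matrix (Fin n) (Fin m) ℝ)) (E : Matrix (Fin n) (Fin m) ℝ) :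
    ∃ a : ℝ, 0 ≤ a ∧ Real.exp (a ^ 2 / (4 * v)) = expSqSum v N E ∧
      ∀ W ∈ N, |frobInner E W| ≤ a := by
  -- The summand 1 keeps the logarithm nonnegative, even for an empty `N`, so `a` can be defined by
  -- a square root.
  have h1 : 1 ≤ expSqSum v N E := by
    have : 0 ≤ ∑ W ∈ N, Real.exp (frobInner E W ^ 2 / (4 * v)) := by positivity
    unfold expSqSum; linarith
  have hlog := Real.log_nonneg h1
  have hsq : √(4 * v * Real.log (expSqSum v N E)) ^ 2 = 4 * v * Real.log (expSqSum v N E) :=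
    Real.sq_sqrt (by positivity)
  refine ⟨√(4 * v * Real.log (expSqSum v N E)), Real.sqrt_nonneg _, ?_, fun W hW => ?_⟩
  · rw [hsq, mul_div_cancel_left₀ _ (by positivity), Real.exp_log (by linarith)]
  · refine Real.abs_le_sqrt ?_
    rw [← div_le_iff₀' (by positivity), Real.le_log_iff_exp_le (by linarith)]
    have := Finset.single_le_sum (f := fun W => Real.exp (frobInner E W ^ 2 / (4 * v)))
      (fun W _ => (Real.exp_pos _).le) hW
    unfold expSqSum
    linarith

/-- Turns an excess over a threshold into an exponential moment, with the threshold becoming a small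
factor. -/
theorem le_mul_exp_div {t : ℝ} (ht : 0 < t) (x : ℝ) : x ≤ t * Real.exp (x / t) := by
  have := Real.add_one_le_exp (x / t)
  have h2 : t * (x / t) = x := mul_div_cancel₀ x ht.ne'
  nlinarith

theorem natCast_mul_exp_neg_add_log_le (n m : ℕ) :
    (n : ℝ) * Real.exp (-(m + Real.log n)) ≤ Real.exp (-m) := by
  rcases Nat.eq_zero_or_pos n with rfl | hn
  · simp [Real.exp_nonneg]
  · rw [neg_add, Real.exp_add, Real.exp_neg (Real.log n), Real.exp_log (by positivity)]
    field_simp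
    exact le_rfl

/-- Pointwise bound on the rows with large noise. -/
theorem max_zero_rowNorm_sq_sub_le {n m : ℕ} {v : ℝ} (hv : 0 < v) {i : Fin n}
    {N : Finset (Matrix (Fin n) (Fin m) ℝ)} (lam : ℝ)
    (E : Matrix (Fin n) (Fin m) ℝ)
    (hN : ∀ a : ℝ, 0 ≤ a → (∀ W ∈ N, |frobInner E W| ≤ a) → rowNorm E i ≤ 2 * a) :
    max 0 (2 * rowNorm E i ^ 2 - lam ^ 2 / 4) ≤
      32 * v * Real.exp (-(lam ^ 2 / (128 * v))) * expSqSum v N E := by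
  obtain ⟨a, ha, hexp, hmax⟩ := exists_bound_of_expSqSum hv N E
  have h1 := hN a ha hmax
  have h2 : rowNorm E i ^ 2 ≤ (2 * a) ^ 2 := pow_le_pow_left₀ (norm_nonneg _) h1 2
  -- The scale `32 * v` turns `8 * a ^ 2` into the exponent `a ^ 2 / (4 * v)` of `expSqSum`.
  have h3 := le_mul_exp_div (by positivity : 0 < 32 * v) (8 * a ^ 2 - lam ^ 2 / 4)
  have h4 : (8 * a ^ 2 - lam ^ 2 / 4) / (32 * v) = -(lam ^ 2 / (128 * v)) + a ^ 2 / (4 * v) := by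
    field_simp; ring
  rw [h4, Real.exp_add, hexp, ← mul_assoc] at h3
  have := expSqSum_nonneg v N E
  exact max_le (by positivity) (by linarith)

/-- Deleting rows is left multiplication by a 0-1 diagonal matrix, so the clean rows again form a
design times `B`, with a design of no larger rank. -/
theorem frobInner_diagonal_mul_sub {n p m : ℕ} (I : Finset (Fin n)) (E : Matrix (Fin n) (Fin m) ℝ)
    (X : Matrix (Fin n) (Fin p) ℝ) (B : Matrix (Fin p) (Fin m) ℝ) :
    ∑ i ∈ Iᶜ, (inner ℝ (WithLp.toLp 2 (E i)) (WithLp.toLp 2 ((X * B) i))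
        - rowNorm (X * B) i ^ 2 / 8) =
      frobInner E (Matrix.diagonal (fun i => if i ∈ I then (0 : ℝ) else 1) * X * B) -
        frobSq (Matrix.diagonal (fun i => if i ∈ I then (0 : ℝ) else 1) * X * B) / 8 := by
  rw [frobInner_eq_sum_inner, frobSq_eq_sum_rowNorm, Finset.sum_div, ← Finset.sum_sub_distrib,
    ← Finset.sum_add_sum_compl I]
  have hrow : ∀ i, (Matrix.diagonal (fun i => if i ∈ I then (0 : ℝ) else 1) * X * B) i =
      if i ∈ I then 0 else (X * B) i := fun i => by
    ext j
    rw [Matrix.mul_assoc, Matrix.diagonal_mul]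
    split_ifs <;> simp
  rw [Finset.sum_eq_zero (s := I), zero_add]
  · refine Finset.sum_congr rfl fun i hi => ?_
    have : i ∉ I := by simpa using hi
    simp only [rowNorm, hrow, this, if_false]
  · intro i hi
    simp only [rowNorm, hrow, hi, if_true]
    simp

/-- Pointwise bound on the clean rows once the rows in `I` have been removed. -/
theorem lowRank_sub_le {n m k d : ℕ} {v : ℝ} (hv : 0 < v)
    {N : Finset (Matrix (Fin n) (Fin m) ℝ)} (lam : ℝ) (E : Matrix (Fin n) (Fin m) ℝ) {x : ℝ}
    (hN : ∀ a : ℝ, 0 ≤ a → (∀ W ∈ N, |frobInner E W| ≤ a) → x ≤ 32 * a ^ 2) :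
    x - k * (lam ^ 2 / 4) ≤ 256 * v * d +
      128 * v * Real.exp (-(2 * d)) * (Real.exp (-(lam ^ 2 / (512 * v))) ^ k * expSqSum v N E) := by
  obtain ⟨a, ha, hexp, hmax⟩ := exists_bound_of_expSqSum hv N E
  have h1 := hN a ha hmax
  -- Subtracting `256 * v * d` at scale `128 * v` yields the factor `exp (-(2 * d))`, which will
  -- cancel a net of size `5 ^ d`.
  have h3 := le_mul_exp_div (by positivity : 0 < 128 * v)
    (32 * a ^ 2 - k * (lam ^ 2 / 4) - 256 * v * d)
  have h4 : (32 * a ^ 2 - k * (lam ^ 2 / 4) - 256 * v * d) / (128 * v) =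
      -(2 * d) + (k * -(lam ^ 2 / (512 * v)) + a ^ 2 / (4 * v)) := by
    field_simp; ring
  rw [h4, Real.exp_add, Real.exp_add, Real.exp_nat_mul, hexp, ← mul_assoc] at h3
  linarith

theorem five_pow_mul_exp_le (d : ℕ) : (5 : ℝ) ^ d * Real.exp (-(2 * d)) ≤ 1 := by
  have h5 : (5 : ℝ) ≤ Real.exp 2 := by
    have := Real.quadratic_le_exp_of_nonneg (x := 2) (by norm_num)
    linarith
  have h : (5 : ℝ) ^ d ≤ Real.exp 2 ^ d := pow_le_pow_left₀ (by norm_num) h5 d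
  calc (5 : ℝ) ^ d * Real.exp (-(2 * d)) ≤ Real.exp 2 ^ d * Real.exp (-(2 * d)) := by gcongr
    _ = 1 := by rw [← Real.exp_nat_mul, ← Real.exp_add]; ring_nf; exact Real.exp_zero

theorem natCast_add_log_nonneg (n m : ℕ) : 0 ≤ (m : ℝ) + Real.log n :=
  add_nonneg (Nat.cast_nonneg _) (Real.log_natCast_nonneg _)

theorem threshLevel_sq (A : ℝ) (σ : ℝ≥0) (n m : ℕ) :
    threshLevel A σ n m ^ 2 = A ^ 2 * (σ : ℝ) ^ 2 * (m + Real.log n) := by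
  rw [threshLevel, mul_pow, mul_pow, Real.sq_sqrt (natCast_add_log_nonneg n m)]

/-! ### The integrable noise bound -/

/-- The stochastic term of the basic inequality is dominated by a random variable of
expected size `σ ^ 2 (q + m) r`. -/
theorem exists_noise_bound {A : ℝ} (hA : 23 ≤ A) {n p m r : ℕ} (hr : 1 ≤ r) (hm : 1 ≤ m)
    {σ : ℝ≥0} (hσ : 0 < σ) (X : Matrix (Fin n) (Fin p) ℝ) {Ω : Type*} [MeasurableSpace Ω]
    {μ : Measure Ω} [IsProbabilityMeasure μ] {E : Ω → Matrix (Fin n) (Fin m) ℝ}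
    (hE : IsGaussianNoise μ σ E) :
    ∃ R : Ω → ℝ, Integrable R μ ∧ ∫ ω, R ω ∂μ ≤ 2000 * ((σ : ℝ) ^ 2 * ((X.rank : ℝ) + m) * r) ∧
      ∀ ω (B : Matrix (Fin p) (Fin m) ℝ) (D : Matrix (Fin n) (Fin m) ℝ), B.rank ≤ 2 * r →
        frobInner (E ω) (X * B + D) - frobSq (X * B + D) / 8
          - ∑ i, hardPenalty (rowNorm D i) (threshLevel A σ n m) ≤ R ω := by
  set lam := threshLevel A σ n m with hlam
  set v : ℝ := (σ : ℝ) ^ 2 with hv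
  set L : ℝ := m + Real.log n with hL
  have hv0 : 0 < v := by positivity
  have hL0 : 0 ≤ L := natCast_add_log_nonneg n m
  have hlam2 : lam ^ 2 = A ^ 2 * v * L := threshLevel_sq A σ n m
  -- Here 23 ^ 2 = 529 suffices: it gives `lam ^ 2 / (512 * v) ≥ L`, hence `ρ ≤ exp (-L)`.
  have hA2 : 512 ≤ A ^ 2 := by nlinarith
  choose Nrow hNrow_card hNrow_le hNrow using fun i : Fin n => exists_row_net (m := m) i
  let Xd : Finset (Fin n) → Matrix (Fin n) (Fin p) ℝ := fun I =>
    Matrix.diagonal (fun i => if i ∈ I then (0 : ℝ) else 1) * X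
  choose N hN_card hN_le hN using fun I => exists_lowRank_net (m := m) (Xd I) (2 * r)
  let d : ℕ := 2 * r * (X.rank + m)
  have hN_card' : ∀ I, (N I).card ≤ 5 ^ d := fun I =>
    (hN_card I).trans (Nat.pow_le_pow_right (by norm_num)
      (Nat.mul_le_mul_left _ (Nat.add_le_add_right (Matrix.rank_mul_le_right _ _) _)))
  let ρ : ℝ := Real.exp (-(lam ^ 2 / (512 * v)))
  let τ : ℝ := Real.exp (-(lam ^ 2 / (128 * v)))
  let R₁ : Ω → ℝ := fun ω => ∑ I : Finset (Fin n), ρ ^ I.card * expSqSum v (N I) (E ω)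
  let R₂ : Ω → ℝ := fun ω => ∑ i, 32 * v * τ * expSqSum v (Nrow i) (E ω)
  have hi₁ : ∀ I : Finset (Fin n), Integrable (fun ω => ρ ^ I.card * expSqSum v (N I) (E ω)) μ :=
    fun I => (hE.integral_expSqSum hσ (hN_le I)).1.const_mul _
  have hi₂ : ∀ i, Integrable (fun ω => 32 * v * τ * expSqSum v (Nrow i) (E ω)) μ :=
    fun i => (hE.integral_expSqSum hσ (hNrow_le i)).1.const_mul _
  have hR₁ : Integrable R₁ μ := integrable_finsetSum _ fun I _ => hi₁ I
  have hR₂ : Integrable R₂ μ := integrable_finsetSum _ fun i _ => hi₂ i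
  have hρ0 : 0 < ρ := Real.exp_pos _
  have hτ0 : 0 < τ := Real.exp_pos _
  have hρ : ρ ≤ Real.exp (-L) := by
    refine Real.exp_le_exp.2 (neg_le_neg ?_)
    rw [hlam2, le_div_iff₀ (by positivity)]
    nlinarith [mul_nonneg hv0.le hL0]
  -- The first factor cancels the row net of size `5 ^ m`, the second the sum over `n` rows.
  have hτ : τ ≤ Real.exp (-(2 * m)) * Real.exp (-L) := by
    rw [← Real.exp_add]
    refine Real.exp_le_exp.2 ?_
    rw [← neg_add]
    refine neg_le_neg ?_
    rw [hlam2, le_div_iff₀ (by positivity)]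
    have : (m : ℝ) ≤ L := by
      have := Real.log_natCast_nonneg n
      linarith
    nlinarith [mul_nonneg hv0.le hL0, mul_le_mul_of_nonneg_left this hv0.le]
  have hnL : (n : ℝ) * Real.exp (-L) ≤ 1 :=
    (natCast_mul_exp_neg_add_log_le n m).trans (Real.exp_le_one_iff.2 (by simp))
  have hpow : ∀ k : ℕ, (1 : ℝ) ≤ 5 ^ k := fun k => one_le_pow₀ (by norm_num)
  have hE₁ : ∫ ω, R₁ ω ∂μ ≤ 9 * 5 ^ d := by
    have h1 : ∀ I : Finset (Fin n),
        ∫ ω, ρ ^ I.card * expSqSum v (N I) (E ω) ∂μ ≤ ρ ^ I.card * (3 * 5 ^ d) := fun I => by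
      rw [integral_const_mul]
      refine mul_le_mul_of_nonneg_left ?_ (by positivity)
      refine (hE.integral_expSqSum hσ (hN_le I)).2.trans ?_
      have : ((N I).card : ℝ) ≤ 5 ^ d := by exact_mod_cast hN_card' I
      linarith [hpow d]
    -- The sum is `(1 + ρ) ^ n`, at most `e` because `n * ρ ≤ 1`: summing over all row subsets costs
    -- only a constant.
    have h2 : ∑ I : Finset (Fin n), ρ ^ I.card ≤ 3 := by
      have h3 := Fintype.sum_pow_mul_eq_add_pow (Fin n) ρ 1
      simp only [one_pow, mul_one, Fintype.card_fin] at h3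
      rw [h3]
      calc (ρ + 1) ^ n ≤ Real.exp ρ ^ n :=
            pow_le_pow_left₀ (by positivity) (Real.add_one_le_exp ρ) n
        _ = Real.exp (n * ρ) := (Real.exp_nat_mul _ _).symm
        _ ≤ Real.exp 1 := Real.exp_le_exp.2
            ((mul_le_mul_of_nonneg_left hρ (Nat.cast_nonneg _)).trans hnL)
        _ ≤ 3 := by linarith [Real.exp_one_lt_d9]
    calc ∫ ω, R₁ ω ∂μ = ∑ I : Finset (Fin n), ∫ ω, ρ ^ I.card * expSqSum v (N I) (E ω) ∂μ :=
          integral_finsetSum _ fun I _ => hi₁ I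
      _ ≤ ∑ I : Finset (Fin n), ρ ^ I.card * (3 * 5 ^ d) := Finset.sum_le_sum fun I _ => h1 I
      _ = (∑ I : Finset (Fin n), ρ ^ I.card) * (3 * 5 ^ d) := (Finset.sum_mul _ _ _).symm
      _ ≤ 3 * (3 * 5 ^ d) := by gcongr
      _ = 9 * 5 ^ d := by ring
  have hE₂ : ∫ ω, R₂ ω ∂μ ≤ 96 * v := by
    have h1 : ∀ i, ∫ ω, 32 * v * τ * expSqSum v (Nrow i) (E ω) ∂μ ≤
        96 * v * Real.exp (-L) := fun i => by
      rw [integral_const_mul]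
      have h2 : ∫ ω, expSqSum v (Nrow i) (E ω) ∂μ ≤ 3 * 5 ^ m := by
        refine (hE.integral_expSqSum hσ (hNrow_le i)).2.trans ?_
        have : ((Nrow i).card : ℝ) ≤ 5 ^ m := by exact_mod_cast hNrow_card i
        linarith [hpow m]
      have h3 : 0 ≤ ∫ ω, expSqSum v (Nrow i) (E ω) ∂μ :=
        integral_nonneg fun ω => expSqSum_nonneg _ _ _
      calc 32 * v * τ * ∫ ω, expSqSum v (Nrow i) (E ω) ∂μ
          ≤ 32 * v * (Real.exp (-(2 * m)) * Real.exp (-L)) * (3 * 5 ^ m) := by gcongr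
        _ = 96 * v * Real.exp (-L) * (5 ^ m * Real.exp (-(2 * m))) := by ring
        _ ≤ 96 * v * Real.exp (-L) :=
            mul_le_of_le_one_right (by positivity) (five_pow_mul_exp_le m)
    calc ∫ ω, R₂ ω ∂μ = ∑ i, ∫ ω, 32 * v * τ * expSqSum v (Nrow i) (E ω) ∂μ :=
          integral_finsetSum _ fun i _ => hi₂ i
      _ ≤ ∑ _i : Fin n, 96 * v * Real.exp (-L) := Finset.sum_le_sum fun i _ => h1 i
      _ = 96 * v * (n * Real.exp (-L)) := by simp; ring
      _ ≤ 96 * v := mul_le_of_le_one_right (by positivity) hnL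
  refine ⟨fun ω => (256 * v * d + 128 * v * Real.exp (-(2 * d)) * R₁ ω) + R₂ ω,
    ((integrable_const _).add (hR₁.const_mul _)).add hR₂, ?_, ?_⟩
  · have hsum : ∫ ω, (256 * v * d + 128 * v * Real.exp (-(2 * d)) * R₁ ω) + R₂ ω ∂μ =
        (256 * v * d + 128 * v * Real.exp (-(2 * d)) * ∫ ω, R₁ ω ∂μ) + ∫ ω, R₂ ω ∂μ := by
      rw [integral_add (by fun_prop) hR₂, integral_add (by fun_prop) (by fun_prop),
        integral_const, integral_const_mul, probReal_univ, one_smul]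
    rw [hsum]
    have h1 : 128 * v * Real.exp (-(2 * d)) * ∫ ω, R₁ ω ∂μ ≤ 1152 * v := by
      calc 128 * v * Real.exp (-(2 * d)) * ∫ ω, R₁ ω ∂μ
          ≤ 128 * v * Real.exp (-(2 * d)) * (9 * 5 ^ d) := by gcongr
        _ = 1152 * v * (5 ^ d * Real.exp (-(2 * d))) := by ring
        _ ≤ 1152 * v := mul_le_of_le_one_right (by positivity) (five_pow_mul_exp_le d)
    have h2 : (d : ℝ) = 2 * ((X.rank + m) * r) := by
      simp only [d]; push_cast; ring
    -- Lets the constants 1152 and 96 be absorbed: 512 + 1152 + 96 ≤ 2000.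
    have h3 : (1 : ℝ) ≤ (X.rank + m) * r := by
      have hm' : (1 : ℝ) ≤ m := by exact_mod_cast hm
      have hr' : (1 : ℝ) ≤ r := by exact_mod_cast hr
      have : (0 : ℝ) ≤ X.rank := Nat.cast_nonneg _
      nlinarith
    have h4 := mul_le_mul_of_nonneg_left h3 hv0.le
    rw [h2] at h1 ⊢
    nlinarith
  · intro ω B D hB
    obtain ⟨I, hI⟩ := frobInner_sub_le (E ω) (X * B) D lam
    refine hI.trans (add_le_add ?_ ?_)
    · rw [frobInner_diagonal_mul_sub]
      refine (lowRank_sub_le (k := I.card) (d := d) hv0 lam (E ω)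
        (fun a ha h => hN I (E ω) a ha h B hB)).trans ?_
      gcongr
      exact Finset.single_le_sum (f := fun I : Finset (Fin n) =>
        ρ ^ I.card * expSqSum v (N I) (E ω))
        (fun I _ => mul_nonneg (by positivity) (expSqSum_nonneg _ _ _)) (Finset.mem_univ I)
    · exact Finset.sum_le_sum fun i _ => max_zero_rowNorm_sq_sub_le hv0 lam (E ω) (hNrow i (E ω))

/-- `exists_noise_bound` including the degenerate cases without noise. -/
theorem exists_noise_bound_ae {A : ℝ} (hA : 23 ≤ A) {n p m r : ℕ} (hr : 1 ≤ r)
    {σ : ℝ≥0} (X : Matrix (Fin n) (Fin p) ℝ) {Ω : Type*} [MeasurableSpace Ω]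
    {μ : Measure Ω} [IsProbabilityMeasure μ] {E : Ω → Matrix (Fin n) (Fin m) ℝ}
    (hE : IsGaussianNoise μ σ E) :
    ∃ R : Ω → ℝ, Integrable R μ ∧ ∫ ω, R ω ∂μ ≤ 2000 * ((σ : ℝ) ^ 2 * ((X.rank : ℝ) + m) * r) ∧
      ∀ᵐ ω ∂μ, ∀ (B : Matrix (Fin p) (Fin m) ℝ) (D : Matrix (Fin n) (Fin m) ℝ), B.rank ≤ 2 * r →
        frobInner (E ω) (X * B + D) - frobSq (X * B + D) / 8
          - ∑ i, hardPenalty (rowNorm D i) (threshLevel A σ n m) ≤ R ω := by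
  by_cases h : 1 ≤ m ∧ 0 < σ
  · obtain ⟨R, h1, h2, h3⟩ := exists_noise_bound hA hr h.1 h.2 X hE
    exact ⟨R, h1, h2, Filter.Eventually.of_forall h3⟩
  · have hlam : 0 ≤ threshLevel A σ n m := by
      unfold threshLevel
      have : 0 ≤ A := by linarith
      positivity
    have hzero : ∀ᵐ ω ∂μ, ∀ i j, E ω i j = 0 := by
      by_cases hm : 1 ≤ m
      · have hσ : σ = 0 := by
          by_contra h0
          exact h ⟨hm, pos_iff_ne_zero.2 h0⟩
        refine ae_all_iff.2 fun i => ae_all_iff.2 fun j => ?_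
        have hlaw := hE.1 i j
        rw [hσ, zero_pow two_ne_zero, gaussianReal_zero_var] at hlaw
        exact hlaw.ae_eq_of_dirac
      · have : m = 0 := by omega
        subst this
        exact Filter.Eventually.of_forall fun ω i j => j.elim0
    refine ⟨fun _ => 0, integrable_zero _ _ _, by simp only [integral_zero]; positivity, ?_⟩
    filter_upwards [hzero] with ω hω B D _
    have h1 : frobInner (E ω) (X * B + D) = 0 := by simp [frobInner, hω]
    have h2 := frobSq_nonneg (X * B + D)
    have h3 : 0 ≤ ∑ i, hardPenalty (rowNorm D i) (threshLevel A σ n m) :=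
      Finset.sum_nonneg fun i _ => hardPenalty_nonneg hlam
    rw [h1]
    linarith

theorem aemeasurable_predErr {n p m : ℕ} (X : Matrix (Fin n) (Fin p) ℝ)
    (Bstar : Matrix (Fin p) (Fin m) ℝ) (Cstar : Matrix (Fin n) (Fin m) ℝ)
    {Ω : Type*} [MeasurableSpace Ω] {μ : Measure Ω}
    {Bh : Ω → Matrix (Fin p) (Fin m) ℝ} {Ch : Ω → Matrix (Fin n) (Fin m) ℝ}
    (hBh : ∀ i j, AEMeasurable (fun ω => Bh ω i j) μ)
    (hCh : ∀ i j, AEMeasurable (fun ω => Ch ω i j) μ) :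
    AEMeasurable (fun ω => predErr X (Bh ω - Bstar) (Ch ω - Cstar)) μ := by
  simp only [predErr, frobSq_eq_sum, Matrix.add_apply, Matrix.mul_apply, Matrix.sub_apply]
  fun_prop

end RobustRRR

/-! ### The oracle inequality -/

theorem corollary1 :
    -- `A₀` is universal; `K` depends only on `A` and on the constant `c` in `P(t; lam) ≤ c lam ^ 2`
    ∃ A₀ : ℝ, 0 < A₀ ∧ ∀ A : ℝ, A₀ ≤ A → ∀ c : ℝ, 0 < c → ∃ K : ℝ, 0 < K ∧
      ∀ (n p m r : ℕ), 1 ≤ r →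
      ∀ (σ : ℝ≥0) (P : ℝ → ℝ → ℝ),
        P 0 (RobustRRR.threshLevel A σ n m) = 0 →
        (∀ t : ℝ, RobustRRR.hardPenalty t (RobustRRR.threshLevel A σ n m) ≤
          P t (RobustRRR.threshLevel A σ n m)) →
        (∀ t : ℝ, P t (RobustRRR.threshLevel A σ n m) ≤
          c * RobustRRR.threshLevel A σ n m ^ 2) →
      ∀ (X : Matrix (Fin n) (Fin p) ℝ)
        (Bstar : Matrix (Fin p) (Fin m) ℝ) (Cstar : Matrix (Fin n) (Fin m) ℝ)
        (Ω : Type*) [MeasurableSpace Ω] (μ : Measure Ω) [IsProbabilityMeasure μ]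
        (E : Ω → Matrix (Fin n) (Fin m) ℝ)
        (Bh : Ω → Matrix (Fin p) (Fin m) ℝ) (Ch : Ω → Matrix (Fin n) (Fin m) ℝ),
        RobustRRR.IsGaussianNoise μ σ E →
        (∀ i j, AEMeasurable (fun ω => Bh ω i j) μ) →
        (∀ i j, AEMeasurable (fun ω => Ch ω i j) μ) →
        (∀ᵐ ω ∂μ, RobustRRR.IsGlobalMinimizer P (RobustRRR.threshLevel A σ n m) r X
          (X * Bstar + Cstar + E ω) (Bh ω) (Ch ω)) →
        Integrable (fun ω => RobustRRR.predErr X (Bh ω - Bstar) (Ch ω - Cstar)) μ ∧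
        (∫ ω, RobustRRR.predErr X (Bh ω - Bstar) (Ch ω - Cstar) ∂μ ≤
          K * ⨅ BC : {BC : Matrix (Fin p) (Fin m) ℝ × Matrix (Fin n) (Fin m) ℝ //
              BC.1.rank ≤ r},
            (RobustRRR.predErr X (BC.1.1 - Bstar) (BC.1.2 - Cstar)
              + (σ : ℝ) ^ 2 * ((X.rank : ℝ) + m) * r
              + (σ : ℝ) ^ 2 * RobustRRR.numNonzeroRows BC.1.2 * m
              + (σ : ℝ) ^ 2 * RobustRRR.numNonzeroRows BC.1.2 * Real.log n)) ∧
        (r = Bstar.rank →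
          ∫ ω, RobustRRR.predErr X (Bh ω - Bstar) (Ch ω - Cstar) ∂μ ≤
            K * ((σ : ℝ) ^ 2 * ((X.rank : ℝ) + m) * Bstar.rank
              + (σ : ℝ) ^ 2 * RobustRRR.numNonzeroRows Cstar * (m + Real.log n))) := by
  -- 8003 = 3 + 4 * 2000 collects the approximation error and the noise; `8 * c * A ^ 2` comes from
  -- `8 * c * lam ^ 2`.
  refine ⟨23, by norm_num, fun A hA c hc => ⟨8003 + 8 * c * A ^ 2, by positivity, ?_⟩⟩
  intro n p m r hr σ P hP0 hP hPc X Bstar Cstar Ω _ μ _ E Bh Ch hE hBh hCh hmin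
  obtain ⟨R, hRint, hRle, hR⟩ := RobustRRR.exists_noise_bound_ae hA hr X hE
  have hlam : 0 ≤ RobustRRR.threshLevel A σ n m := by
    unfold RobustRRR.threshLevel
    have : 0 ≤ A := by linarith
    positivity
  have hpt : ∀ B : Matrix (Fin p) (Fin m) ℝ, ∀ C : Matrix (Fin n) (Fin m) ℝ, B.rank ≤ r →
      ∀ᵐ ω ∂μ, RobustRRR.predErr X (Bh ω - Bstar) (Ch ω - Cstar) ≤
        (3 * RobustRRR.predErr X (B - Bstar) (C - Cstar) +
          8 * (c * RobustRRR.threshLevel A σ n m ^ 2) * RobustRRR.numNonzeroRows C) + 4 * R ω := by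
    intro B C hB
    filter_upwards [hmin, hR] with ω h1 h2
    exact RobustRRR.predErr_le_of_isGlobalMinimizer hlam hP0 hP hPc hB h1 h2
  have hint : Integrable (fun ω => RobustRRR.predErr X (Bh ω - Bstar) (Ch ω - Cstar)) μ := by
    -- The competitor `(0, 0)` is always feasible and gives an integrable majorant.
    refine Integrable.mono' (g := fun ω => (3 * RobustRRR.predErr X (0 - Bstar) (0 - Cstar) +
        8 * (c * RobustRRR.threshLevel A σ n m ^ 2) *
          RobustRRR.numNonzeroRows (0 : Matrix (Fin n) (Fin m) ℝ)) + 4 * R ω) (by fun_prop)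
      (RobustRRR.aemeasurable_predErr X Bstar Cstar hBh hCh).aestronglyMeasurable ?_
    filter_upwards [hpt 0 0 (by simp)] with ω h
    rwa [RobustRRR.predErr, Real.norm_of_nonneg (RobustRRR.frobSq_nonneg _)]
  have hmain : ∀ B : Matrix (Fin p) (Fin m) ℝ, ∀ C : Matrix (Fin n) (Fin m) ℝ, B.rank ≤ r →
      ∫ ω, RobustRRR.predErr X (Bh ω - Bstar) (Ch ω - Cstar) ∂μ ≤
        (8003 + 8 * c * A ^ 2) * (RobustRRR.predErr X (B - Bstar) (C - Cstar)
          + (σ : ℝ) ^ 2 * ((X.rank : ℝ) + m) * r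
          + (σ : ℝ) ^ 2 * RobustRRR.numNonzeroRows C * m
          + (σ : ℝ) ^ 2 * RobustRRR.numNonzeroRows C * Real.log n) := by
    intro B C hB
    have h1 := integral_mono_ae hint ((integrable_const _).add (hRint.const_mul 4)) (hpt B C hB)
    simp only [Pi.add_apply] at h1
    rw [integral_add (integrable_const _) (hRint.const_mul 4), integral_const_mul] at h1
    simp only [integral_const, probReal_univ, one_smul] at h1
    rw [RobustRRR.threshLevel_sq] at h1
    have hM : 0 ≤ RobustRRR.predErr X (B - Bstar) (C - Cstar) := RobustRRR.frobSq_nonneg _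
    have hq : 0 ≤ (σ : ℝ) ^ 2 * ((X.rank : ℝ) + m) * r := by positivity
    have hJ : 0 ≤ (σ : ℝ) ^ 2 * RobustRRR.numNonzeroRows C * (m + Real.log n) :=
      mul_nonneg (by positivity) (RobustRRR.natCast_add_log_nonneg n m)
    have hk : 0 ≤ 8 * c * A ^ 2 := by positivity
    nlinarith [mul_nonneg hk hM, mul_nonneg hk hq, mul_nonneg hk hJ]
  refine ⟨hint, ?_, ?_⟩
  · rw [Real.mul_iInf_of_nonneg (by positivity)]
    have : Nonempty {BC : Matrix (Fin p) (Fin m) ℝ × Matrix (Fin n) (Fin m) ℝ //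
        BC.1.rank ≤ r} := ⟨⟨(0, 0), by simp⟩⟩
    exact le_ciInf fun BC => hmain BC.1.1 BC.1.2 BC.2
  · intro hrank
    have h := hmain Bstar Cstar hrank.ge
    have h0 : RobustRRR.predErr X (Bstar - Bstar) (Cstar - Cstar) = 0 := by
      simp [RobustRRR.predErr, RobustRRR.frobSq_eq_sum]
    rw [h0, hrank] at h
    refine h.trans (le_of_eq ?_)
    ring
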